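/- For a finite sequence $a=(a_1,\dots,a_n)$ of elements of a totally ordered set, a subsequence $(a_{\ell_1},\dots,a_{\ell_m})$ with $\ell_1<\dots<\ell_m$ is called alternating if $a_{\ell_1}>a_{\ell_2}<a_{\ell_3}>\cdots a_{\ell_m}$ (the first comparison being $>$), and $\mathrm{LA}_n(a)$ denotes the largest $m$ such that $a$ has an alternating subsequence of length $m$. For each $n$, let $\boldsymbol\tau$ be a uniform random permutation in the symmetric group $\mathcal S_n$, regarded as the sequence $(\boldsymbol\tau_1,\dots,\boldsymbol\tau_n)$. Then $$\mathbf E[\mathrm{LA}_n(\boldsymbol\tau)]=\frac{2n}{3}+\frac16\quad (n\ge 2),\qquad \operatorname{Var}[\mathrm{LA}_n(\boldsymbol\tau)]=\frac{8n}{45}-\frac{13}{180}\quad (n\ge 4).$$ Moreover, as $n\to\infty$, $$\frac{\mathrm{LA}_n(\boldsymbol\tau)-2n/3}{\sqrt{8n/45}}\Longrightarrow \mathcal Z,$$ where $\mathcal Z$ is a standard normal random variable and $\Longrightarrow$ denotes convergence in distribution. -/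

import Mathlib

open MeasureTheory ProbabilityTheory Filter

/-- `a` has an alternating subsequence of length `m`: there are indices `ℓ 0 < ⋯ < ℓ (m - 1)` with
`a (ℓ 0) > a (ℓ 1) < a (ℓ 2) > ⋯` (the first comparison is `>`). -/
def HasAlternatingSubseq {Λ : Type*} [LinearOrder Λ] {n : ℕ} (a : Fin n → Λ) (m : ℕ) : Prop :=
  ∃ ℓ : Fin m → Fin n, StrictMono ℓ ∧
    ∀ i j : Fin m, (j : ℕ) = (i : ℕ) + 1 →
      (Even (i : ℕ) → a (ℓ j) < a (ℓ i)) ∧ (Odd (i : ℕ) → a (ℓ i) < a (ℓ j))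

/-- The length of the longest alternating subsequence of `a`. -/
noncomputable def LA {Λ : Type*} [LinearOrder Λ] {n : ℕ} (a : Fin n → Λ) : ℕ :=
  sSup {m | HasAlternatingSubseq a m}

/-- The supremum defining `LA a` is a maximum. -/
theorem isGreatest_LA {Λ : Type*} [LinearOrder Λ] {n : ℕ} (a : Fin n → Λ) :
    IsGreatest {m | HasAlternatingSubseq a m} (LA a) := by
  have hb : BddAbove {m | HasAlternatingSubseq a m} := by
    refine ⟨n, ?_⟩
    rintro m ⟨ℓ, hℓ, -⟩
    simpa using Fintype.card_le_of_injective ℓ hℓ.injective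
  have hne : {m | HasAlternatingSubseq a m}.Nonempty :=
    ⟨0, Fin.elim0, fun i => i.elim0, fun i => i.elim0⟩
  exact ⟨Nat.sSup_mem hne hb, fun m hm => le_csSup hb hm⟩

/-- The symmetric group on `n` letters carries the discrete σ-algebra. -/
instance instMeasurableSpacePermFin (n : ℕ) : MeasurableSpace (Equiv.Perm (Fin n)) := ⊤

instance instDiscreteMeasurableSpacePermFin (n : ℕ) :
    DiscreteMeasurableSpace (Equiv.Perm (Fin n)) := ⟨fun _ => trivial⟩

/-- The uniform probability measure on the symmetric group on `n` letters. -/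
noncomputable def uniformPerm (n : ℕ) : Measure (Equiv.Perm (Fin n)) :=
  uniformOn Set.univ

/-! A longest alternating subsequence picks one term from each change of direction: for a sequence
without equal neighbours its length is `1`, plus `1` if the first step is a descent, plus the number
of interior positions where the sequence turns (`LA_eq_altCount`, `altCount_eq_sum`). Only the
relative order matters, so the uniform permutation may be replaced by independent Gaussians
(`identDistrib_LA_altCount`). The turn indicators then form a stationary sequence in which turns at
distance at least three are independent.

Moments of finitely many indicators are averages over small symmetric groups
(`integral_of_relativeOrder`). A turn has probability `2/3` and variance `2/9`, its covariances at
distances one and two are `-1/36` and `1/180`, and the first descent is uncorrelated with every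
turn. Summing gives the exact mean and variance, with growth `2/9 - 2/36 + 2/180 = 8/45` per step.

For the limit law the positions are cut into blocks of length `q + 4`. The turns inside a block
depend on that block only, so the block sums are i.i.d. and obey the classical central limit
theorem. The two turns straddling each pair of neighbouring blocks have an `L¹` contribution of
order `√(n / q)`, negligible after normalization when `n → ∞` and then `q → ∞`. Characteristic
functions carry this double limit (`tendsto_of_approx`). -/

/-! ### Greedy evaluation of the longest alternating subsequence -/

/-- The length of the longest alternating subsequence of `x 0, …, x j`, computed greedily: it grows
when the step from `j` to `j + 1` changes direction. -/
noncomputable def altCount (x : ℕ → ℝ) : ℕ → ℕ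
  | 0 => 1
  | j + 1 => if (Even (altCount x j) ↔ x (j + 1) < x j) then altCount x j else altCount x j + 1

/-- `1` if the monotonicity changes at the middle term, `0` otherwise. -/
def turn {Λ : Type*} [LinearOrder Λ] (a b c : Λ) : ℕ := if (b < a ↔ c < b) then 0 else 1

/-- `1` if the step is a descent, `0` otherwise. -/
def descent {Λ : Type*} [LinearOrder Λ] (a b : Λ) : ℕ := if b < a then 1 else 0

/-- Parity is the memory of the greedy recursion: the count is incremented exactly when its parity
disagrees with the direction of the new step, so afterwards the two agree. -/
lemma even_altCount_succ (x : ℕ → ℝ) (j : ℕ) :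
    Even (altCount x (j + 1)) ↔ x (j + 1) < x j := by
  rw [altCount]
  split_ifs with h
  · exact h
  · rw [Nat.even_add_one]
    tauto

lemma altCount_one (x : ℕ → ℝ) : altCount x 1 = 1 + descent (x 0) (x 1) := by
  by_cases h : x 1 < x 0 <;> simp [altCount, descent, h]

lemma altCount_add_two (x : ℕ → ℝ) (j : ℕ) :
    altCount x (j + 2) = altCount x (j + 1) + turn (x j) (x (j + 1)) (x (j + 2)) := by
  rw [altCount, turn]
  simp only [even_altCount_succ]
  split_ifs <;> rfl

lemma altCount_eq_sum (x : ℕ → ℝ) (m : ℕ) :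
    altCount x (m + 1) = 1 + descent (x 0) (x 1) +
      ∑ i ∈ Finset.range m, turn (x i) (x (i + 1)) (x (i + 2)) := by
  induction m with
  | zero => simp [altCount_one]
  | succ m ih => rw [altCount_add_two, ih, Finset.sum_range_succ, add_assoc]

lemma monotone_altCount (x : ℕ → ℝ) : Monotone (altCount x) := by
  refine monotone_nat_of_le_succ fun j => ?_
  rw [altCount]
  split_ifs <;> omega

lemma altCount_pos (x : ℕ → ℝ) (j : ℕ) : 0 < altCount x j :=
  (monotone_altCount x (Nat.zero_le j)).trans_lt' (by simp [altCount])

lemma exists_descent_of_lt {x : ℕ → ℝ} {a b : ℕ} (hab : a < b) (h : x b < x a) :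
    ∃ p, a ≤ p ∧ p < b ∧ x (p + 1) < x p := by
  by_contra! hc
  have key : ∀ c, a ≤ c → c ≤ b → x a ≤ x c := by
    intro c hc1
    induction c, hc1 using Nat.le_induction with
    | base => simp
    | succ c hc1 ih => exact fun hc2 => (ih (by omega)).trans (hc c hc1 (by omega))
  exact absurd (key b hab.le le_rfl) (not_le.2 h)

lemma exists_ascent_of_lt {x : ℕ → ℝ} {a b : ℕ} (hab : a < b) (h : x a < x b) :
    ∃ p, a ≤ p ∧ p < b ∧ x p < x (p + 1) := by
  obtain ⟨p, h1, h2, h3⟩ := exists_descent_of_lt (x := fun i => -x i) hab (by simpa using h)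
  exact ⟨p, h1, h2, by simpa using h3⟩

lemma HasAlternatingSubseq.le_altCount {x : ℕ → ℝ} {n m : ℕ}
    (h : HasAlternatingSubseq (fun i : Fin n => x i) m) : m ≤ altCount x (n - 1) := by
  obtain ⟨ℓ, hℓ, halt⟩ := h
  -- Between two chosen indices some single step goes in the required direction. The parity of the
  -- count just after it excludes the value `i + 1`, so by monotonicity the count has reached `i +
  -- 2`.
  have key : ∀ i (hi : i < m), i + 1 ≤ altCount x (ℓ ⟨i, hi⟩) := by
    intro i
    induction i with
    | zero => exact fun _ => altCount_pos _ _
    | succ i ih =>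
      intro hi
      have hi' := ih (by omega)
      have hlt : (ℓ ⟨i, by omega⟩ : ℕ) < ℓ ⟨i + 1, hi⟩ := hℓ (by simp)
      obtain ⟨he, ho⟩ := halt ⟨i, by omega⟩ ⟨i + 1, hi⟩ rfl
      obtain ⟨p, hp1, hp2, hp3⟩ : ∃ p, (ℓ ⟨i, by omega⟩ : ℕ) ≤ p ∧ p < ℓ ⟨i + 1, hi⟩ ∧
          (Even i ↔ x (p + 1) < x p) := by
        rcases Nat.even_or_odd i with hev | hod
        · obtain ⟨p, h1, h2, h3⟩ := exists_descent_of_lt hlt (he hev)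
          exact ⟨p, h1, h2, by tauto⟩
        · obtain ⟨p, h1, h2, h3⟩ := exists_ascent_of_lt hlt (ho hod)
          exact ⟨p, h1, h2, by simp [Nat.not_even_iff_odd.2 hod, h3.le]⟩
      rw [← even_altCount_succ] at hp3
      have h1 := monotone_altCount x (show (ℓ ⟨i, by omega⟩ : ℕ) ≤ p + 1 by omega)
      have h2 := monotone_altCount x (show p + 1 ≤ ℓ ⟨i + 1, hi⟩ by omega)
      have h3 : altCount x (p + 1) ≠ i + 1 := by
        intro h
        rw [h, Nat.even_add_one] at hp3
        tauto
      omega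
  rcases m with _ | m
  · simp
  · refine (key m (by omega)).trans (monotone_altCount x ?_)
    have := (ℓ ⟨m, by omega⟩).2
    omega

/-- The subsequence is kept ending at the current index: a step that continues the current direction
moves the last term from `j` to `j + 1`, any other step appends `j + 1`. Without equal neighbours a
step that is not a descent is a strict ascent. Only the values of `s` below the count are
meaningful. -/
lemma exists_alternating_altCount {x : ℕ → ℝ} (hx : ∀ j, x (j + 1) ≠ x j) (j : ℕ) :
    ∃ s : ℕ → ℕ, (∀ i k, i < k → k < altCount x j → s i < s k) ∧
      (∀ i, i + 1 < altCount x j → (Even i → x (s (i + 1)) < x (s i)) ∧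
        (Odd i → x (s i) < x (s (i + 1)))) ∧ s (altCount x j - 1) = j := by
  induction j with
  | zero => exact ⟨fun _ => 0, by simp only [altCount]; omega, by simp [altCount]⟩
  | succ j ih =>
    obtain ⟨s, hs, halt, hlast⟩ := ih
    have hpos := altCount_pos x j
    rw [altCount]
    set c := altCount x j
    have hle : ∀ i < c, s i ≤ j := by
      intro i hi
      rcases eq_or_ne i (c - 1) with rfl | hne
      · exact hlast.le
      · exact hlast ▸ (hs i (c - 1) (by omega) (by omega)).le
    split_ifs with h
    · refine ⟨Function.update s (c - 1) (j + 1), ?_, ?_, by simp⟩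
      · intro i k hik hk
        rw [Function.update_of_ne (show i ≠ c - 1 by omega)]
        rcases eq_or_ne k (c - 1) with rfl | hne
        · rw [Function.update_self]
          have := hle i (by omega)
          omega
        · rw [Function.update_of_ne hne]
          exact hs i k hik hk
      · intro i hi
        rw [Function.update_of_ne (show i ≠ c - 1 by omega)]
        have := halt i hi
        rcases eq_or_ne (i + 1) (c - 1) with heq | hne
        · have hci : c = i + 2 := by omega
          rw [heq, Function.update_self]
          rw [heq, hlast] at this
          rw [hci, Nat.even_add] at h
          simp only [even_two, iff_true] at h
          refine ⟨fun hev => (h.1 hev).trans (this.1 hev), fun hod => (this.2 hod).trans ?_⟩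
          have := mt h.2 (Nat.not_even_iff_odd.2 hod)
          exact lt_of_le_of_ne (not_lt.1 this) (hx j).symm
        · rwa [Function.update_of_ne hne]
    · refine ⟨Function.update s c (j + 1), ?_, ?_, by simp⟩
      · intro i k hik hk
        rw [Function.update_of_ne (show i ≠ c by omega)]
        rcases eq_or_ne k c with rfl | hne
        · rw [Function.update_self]
          have := hle i (by omega)
          omega
        · rw [Function.update_of_ne hne]
          exact hs i k hik (by omega)
      · intro i hi
        rw [Function.update_of_ne (show i ≠ c by omega)]
        rcases eq_or_ne (i + 1) c with heq | hne
        · have hl : s i = j := by rw [← hlast, ← heq]; rfl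
          rw [heq, Function.update_self, hl]
          have hev : Even i ↔ x (j + 1) < x j := by
            rw [← heq, Nat.even_add_one] at h
            tauto
          refine ⟨hev.1, fun hod => ?_⟩
          have := mt hev.2 (Nat.not_even_iff_odd.2 hod)
          exact lt_of_le_of_ne (not_lt.1 this) (hx j).symm
        · rw [Function.update_of_ne hne]
          exact halt i (by omega)

lemma LA_eq_altCount {x : ℕ → ℝ} (hx : ∀ j, x (j + 1) ≠ x j) (n : ℕ) :
    LA (fun i : Fin (n + 1) => x i) = altCount x n := by
  have hg := isGreatest_LA (fun i : Fin (n + 1) => x i)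
  refine le_antisymm hg.1.le_altCount (hg.2 ?_)
  obtain ⟨s, hs, halt, hlast⟩ := exists_alternating_altCount hx n
  have hpos := altCount_pos x n
  have hle : ∀ i < altCount x n, s i ≤ n := by
    intro i hi
    rcases eq_or_ne i (altCount x n - 1) with rfl | hne
    · exact hlast.le
    · exact (hs i (altCount x n - 1) (by omega) (by omega)).le.trans hlast.le
  refine ⟨fun i => ⟨s i, Nat.lt_succ_of_le (hle i i.2)⟩, fun i k hik => hs i k hik k.2, ?_⟩
  intro i j hij
  have := halt i (hij ▸ j.2)
  rw [← hij] at this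
  exact this

/-! ### Order invariance and measurability -/

lemma hasAlternatingSubseq_comp_strictMono {Λ Λ' : Type*} [LinearOrder Λ] [LinearOrder Λ'] {n : ℕ}
    {h : Λ → Λ'} (hh : StrictMono h) (a : Fin n → Λ) (m : ℕ) :
    HasAlternatingSubseq (h ∘ a) m ↔ HasAlternatingSubseq a m := by
  simp only [HasAlternatingSubseq, Function.comp_apply, hh.lt_iff_lt]

lemma LA_comp_strictMono {Λ Λ' : Type*} [LinearOrder Λ] [LinearOrder Λ'] {n : ℕ}
    {h : Λ → Λ'} (hh : StrictMono h) (a : Fin n → Λ) : LA (h ∘ a) = LA a := by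
  simp only [LA, hasAlternatingSubseq_comp_strictMono hh]

lemma measurable_LA (n : ℕ) : Measurable (fun a : Fin n → ℝ => LA a) := by
  have hm : ∀ m, MeasurableSet {a : Fin n → ℝ | HasAlternatingSubseq a m} := by
    intro m
    have hlt : ∀ p q : Fin n, Measurable fun a : Fin n → ℝ => a p < a q := fun p q =>
      measurable_to_prop (by
        simpa [Set.preimage] using
          measurableSet_lt (measurable_pi_apply (X := fun _ : Fin n => ℝ) p)
            (measurable_pi_apply q))
    refine Measurable.setOf ?_
    unfold HasAlternatingSubseq
    refine Measurable.exists fun ℓ => Measurable.and measurable_const <|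
      Measurable.forall fun i => Measurable.forall fun j => Measurable.imp measurable_const <|
      Measurable.and (Measurable.imp measurable_const (hlt _ _))
        (Measurable.imp measurable_const (hlt _ _))
  refine measurable_to_countable' fun m => ?_
  have : (fun a : Fin n → ℝ => LA a) ⁻¹' {m} =
      {a | HasAlternatingSubseq a m} ∩ ⋂ k, {a | HasAlternatingSubseq a k → k ≤ m} := by
    ext a
    simp only [Set.mem_preimage, Set.mem_singleton_iff, Set.mem_inter_iff, Set.mem_ofPred_eq,
      Set.mem_iInter]
    constructor
    · rintro rfl
      exact ⟨(isGreatest_LA a).1, fun k hk => (isGreatest_LA a).2 hk⟩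
    · rintro ⟨h1, h2⟩
      exact (isGreatest_LA a).unique ⟨h1, h2⟩
  rw [this]
  refine (hm m).inter (MeasurableSet.iInter fun k => ?_)
  by_cases hk : k ≤ m
  · simp [hk]
  · simp only [hk, imp_false]
    exact (hm k).compl

/-! ### Transfer from permutations to independent variables -/

/-- The law of a sequence of independent standard normal variables. -/
noncomputable abbrev iidGaussian : Measure (ℕ → ℝ) := Measure.infinitePi fun _ => gaussianReal 0 1

lemma iidGaussian_map_injective {ι : Type*} {e : ι → ℕ} (he : Function.Injective e) :
    iidGaussian.map (fun x i => x (e i)) = Measure.infinitePi fun _ : ι => gaussianReal 0 1 :=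
  Measure.map_infinitePi_infinitePi_of_inj he

lemma ae_injective_iidGaussian : ∀ᵐ x ∂iidGaussian, Function.Injective x := by
  have : NullSingletonClass (gaussianReal 0 1) := nullSingletonClass_gaussianReal one_ne_zero
  have key : ∀ i j : ℕ, i ≠ j → ∀ᵐ x ∂iidGaussian, x i ≠ x j := by
    intro i j hij
    have hmap := Measure.infinitePi_map_eval_prod (P := fun _ : ℕ => gaussianReal 0 1) hij
    have hmeas : MeasurableSet {p : ℝ × ℝ | p.1 = p.2} :=
      measurableSet_eq_fun measurable_fst measurable_snd
    have h0 : ((gaussianReal 0 1).prod (gaussianReal 0 1)) {p : ℝ × ℝ | p.1 = p.2} = 0 := by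
      rw [Measure.measure_prod_null hmeas]
      refine ae_of_all _ fun a => ?_
      have : Prod.mk a ⁻¹' {p : ℝ × ℝ | p.1 = p.2} = {a} := by
        ext b
        simp [eq_comm]
      simp [this]
    rw [← hmap, Measure.map_apply (by fun_prop) hmeas] at h0
    exact measure_eq_zero_iff_ae_notMem.1 h0
  have : ∀ᵐ x ∂iidGaussian, ∀ i j : ℕ, i ≠ j → x i ≠ x j := by
    simp only [ae_all_iff]
    exact key
  filter_upwards [this] with x hx i j h
  by_contra hne
  exact hx i j hne h

lemma exists_strictMono_comp_perm {k : ℕ} {u : Fin k → ℝ} (hu : Function.Injective u) :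
    ∃ h : Fin k → ℝ, StrictMono h ∧ ∃ π : Equiv.Perm (Fin k), u = h ∘ π := by
  refine ⟨u ∘ Tuple.sort u, (Tuple.monotone_sort u).strictMono_of_injective
    (hu.comp (Tuple.sort u).injective), (Tuple.sort u)⁻¹, ?_⟩
  ext i
  simp

/-- The expectation of a function of the relative order of finitely many independent standard
normal variables is its average over all permutations. -/
lemma integral_of_relativeOrder {k : ℕ} {e : Fin k → ℕ} (he : Function.Injective e)
    {f : (Fin k → ℝ) → ℝ} (hf : Measurable f) {F : Equiv.Perm (Fin k) → ℝ}
    (hF : ∀ h : Fin k → ℝ, StrictMono h → ∀ π : Equiv.Perm (Fin k), f (h ∘ π) = F π) :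
    ∫ x, f (fun i => x (e i)) ∂iidGaussian = (∑ π, F π) / k.factorial := by
  have hperm : ∀ σ : Equiv.Perm (Fin k),
      ∫ x, f (fun i => x (e (σ i))) ∂iidGaussian = ∫ x, f (fun i => x (e i)) ∂iidGaussian := by
    have h : ∀ e : Fin k → ℕ, Function.Injective e → ∫ x, f (fun i => x (e i)) ∂iidGaussian =
        ∫ u, f u ∂(Measure.infinitePi fun _ : Fin k => gaussianReal 0 1) := by
      intro e he
      rw [← iidGaussian_map_injective he, integral_map]
      · exact (by fun_prop : Measurable fun (x : ℕ → ℝ) i => x (e i)).aemeasurable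
      · exact hf.aestronglyMeasurable
    intro σ
    exact (h _ (he.comp σ.injective)).trans (h e he).symm
  have hint : ∀ σ : Equiv.Perm (Fin k),
      Integrable (fun x : ℕ → ℝ => f (fun i => x (e (σ i)))) iidGaussian := by
    intro σ
    refine Integrable.of_bound (C := ∑ π, |F π|)
      (by fun_prop : Measurable fun x : ℕ → ℝ => f (fun i => x (e (σ i)))).aestronglyMeasurable ?_
    filter_upwards [ae_injective_iidGaussian] with x hx
    obtain ⟨h, hh, π, hπ⟩ := exists_strictMono_comp_perm (hx.comp (he.comp σ.injective))
    change |f (x ∘ (e ∘ σ))| ≤ _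
    rw [hπ, hF h hh]
    exact Finset.single_le_sum (f := fun π => |F π|) (fun _ _ => abs_nonneg _) (Finset.mem_univ π)
  -- Almost surely the entries are distinct. As `σ` runs over all permutations, so does the relative
  -- order of the reindexed entries, and the sum is almost surely constant; by exchangeability its
  -- `k!` terms have equal integrals.
  have hsum : ∑ σ : Equiv.Perm (Fin k), ∫ x, f (fun i => x (e (σ i))) ∂iidGaussian = ∑ π, F π := by
    rw [← integral_finsetSum _ fun σ _ => hint σ]
    have : (fun x : ℕ → ℝ => ∑ σ : Equiv.Perm (Fin k), f (fun i => x (e (σ i)))) =ᵐ[iidGaussian]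
        fun _ => ∑ π, F π := by
      filter_upwards [ae_injective_iidGaussian] with x hx
      obtain ⟨h, hh, π, hπ⟩ := exists_strictMono_comp_perm (hx.comp he)
      rw [← Equiv.sum_comp (Equiv.mulLeft π) F]
      refine Finset.sum_congr rfl fun σ _ => ?_
      rw [Equiv.coe_mulLeft, ← hF h hh]
      congr 1
      ext i
      exact congrFun hπ (σ i)
    rw [integral_congr_ae this]
    simp
  simp only [hperm] at hsum
  rw [Finset.sum_const, Finset.card_univ, Fintype.card_perm, Fintype.card_fin, nsmul_eq_mul] at hsum
  rw [← hsum, mul_div_cancel_left₀]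
  exact_mod_cast k.factorial_ne_zero

lemma LA_eq_altCount_ae (n : ℕ) :
    (fun x : ℕ → ℝ => LA (fun i : Fin (n + 1) => x i)) =ᵐ[iidGaussian] fun x => altCount x n := by
  filter_upwards [ae_injective_iidGaussian] with x hx
  exact LA_eq_altCount (fun j => hx.ne (by simp)) n

/-- The longest alternating subsequence of a uniform permutation has the same law as that of
independent standard normal variables. -/
lemma identDistrib_LA_altCount {Ω : Type*} [MeasurableSpace Ω] {P : Measure Ω} {n : ℕ}
    {τ : Ω → Equiv.Perm (Fin (n + 1))} (hτ : HasLaw τ (uniformPerm (n + 1)) P) :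
    IdentDistrib (fun ω => LA (τ ω)) (fun x => altCount x n) P iidGaussian := by
  have hLA : Measurable fun x : ℕ → ℝ => LA (fun i : Fin (n + 1) => x i) :=
    (measurable_LA (n + 1)).comp (by fun_prop)
  have hperm : Measurable fun π : Equiv.Perm (Fin (n + 1)) => LA π := Measurable.of_discrete
  refine ⟨hperm.comp_aemeasurable hτ.aemeasurable,
    hLA.aemeasurable.congr (LA_eq_altCount_ae n), ?_⟩
  have hcomp : P.map (fun ω => LA (τ ω)) = (uniformPerm (n + 1)).map
      (fun π : Equiv.Perm (Fin (n + 1)) => LA π) := by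
    rw [← hτ.map_eq, AEMeasurable.map_map_of_aemeasurable hperm.aemeasurable hτ.aemeasurable]
    rfl
  have : IsProbabilityMeasure (uniformPerm (n + 1)) :=
    instIsProbabilityMeasure_uniformOn_univ
  have := Measure.isProbabilityMeasure_map (μ := uniformPerm (n + 1)) hperm.aemeasurable
  have := Measure.isProbabilityMeasure_map (μ := iidGaussian) hLA.aemeasurable
  rw [hcomp, ← Measure.map_congr (LA_eq_altCount_ae n)]
  refine Measure.ext_of_measureReal_singleton fun m => ?_
  have hs : MeasurableSet ({m} : Set ℕ) := measurableSet_singleton m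
  rw [map_measureReal_apply hperm hs, map_measureReal_apply hLA hs]
  have h1 : (iidGaussian.real ((fun x : ℕ → ℝ => LA (fun i : Fin (n + 1) => x i)) ⁻¹' {m})) =
      ∫ x, (fun u : Fin (n + 1) → ℝ => if LA u = m then (1 : ℝ) else 0)
        (fun i : Fin (n + 1) => x (i : ℕ)) ∂iidGaussian := by
    rw [← integral_indicator_one (hLA hs)]
    congr 1
    ext x
    classical
    rw [Set.indicator_apply]
    exact if_congr Iff.rfl rfl rfl
  rw [h1, integral_of_relativeOrder (e := fun i : Fin (n + 1) => (i : ℕ))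
    (f := fun u => if LA u = m then (1 : ℝ) else 0)
    (F := fun π => if LA π = m then (1 : ℝ) else 0)
    Fin.val_injective (Measurable.ite (measurable_LA _ hs) measurable_const measurable_const)
    (fun h hh π => by rw [LA_comp_strictMono hh])]
  have hset : (fun π : Equiv.Perm (Fin (n + 1)) => LA π) ⁻¹' {m} =
      ((Finset.univ.filter fun π : Equiv.Perm (Fin (n + 1)) => LA π = m :
        Finset (Equiv.Perm (Fin (n + 1)))) : Set (Equiv.Perm (Fin (n + 1)))) := by
    ext π
    simp
  rw [measureReal_def, uniformPerm, uniformOn_univ, Fintype.card_perm, Fintype.card_fin,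
    Finset.sum_boole, ENNReal.toReal_div, ENNReal.toReal_natCast, hset,
    Measure.count_apply_finset, ENNReal.toReal_natCast]

/-! ### Independence of disjoint windows -/

/-- Functions of disjoint blocks of coordinates are independent. -/
lemma iIndepFun_blocks {κ : Type*} {w : ℕ} {e : κ → Fin w → ℕ}
    (he : Function.Injective fun p : κ × Fin w => e p.1 p.2) :
    iIndepFun (fun (b : κ) (x : ℕ → ℝ) (j : Fin w) => x (e b j)) iidGaussian := by
  rw [iIndepFun_iff_map_fun_eq_infinitePi_map (fun b => by fun_prop)]
  have h1 : ∀ b, iidGaussian.map (fun (x : ℕ → ℝ) (j : Fin w) => x (e b j)) =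
      Measure.infinitePi fun _ : Fin w => gaussianReal 0 1 := fun b =>
    iidGaussian_map_injective (fun i j hij => by
      have := @he (b, i) (b, j) hij
      simpa using this)
  simp only [h1]
  -- Currying identifies the product law over all pairs (block, offset) with the product over blocks
  -- of the product laws inside them.
  rw [← Measure.infinitePi_map_curry (fun (_ : κ) (_ : Fin w) => gaussianReal 0 1),
    ← iidGaussian_map_injective he, Measure.map_map (MeasurableEquiv.measurable _) (by fun_prop)]
  rfl

lemma indepFun_blocks {w : ℕ} {a b : ℕ} (hab : a + w ≤ b) {f g : (Fin w → ℝ) → ℝ}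
    (hf : Measurable f) (hg : Measurable g) :
    IndepFun (fun x : ℕ → ℝ => f fun j => x (a + j)) (fun x : ℕ → ℝ => g fun j => x (b + j))
      iidGaussian := by
  have h := iIndepFun_blocks (e := fun (c : Bool) (j : Fin w) => (bif c then b else a) + j) (by
    rintro ⟨c, i⟩ ⟨d, j⟩ hij
    have hi := i.2
    have hj := j.2
    rcases c <;> rcases d <;> simp only [cond_true, cond_false] at hij <;> simp <;> omega)
  exact (h.indepFun (show false ≠ true by simp)).comp hf hg

/-! ### Turn indicators and their mixed moments -/

lemma measurable_turn {α : Type*} [MeasurableSpace α] {a b c : α → ℝ} (ha : Measurable a)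
    (hb : Measurable b) (hc : Measurable c) :
    Measurable fun t => (turn (a t) (b t) (c t) : ℝ) := by
  have h1 : MeasurableSet {t | b t < a t} := measurableSet_lt hb ha
  have h2 : MeasurableSet {t | c t < b t} := measurableSet_lt hc hb
  have : (fun t => (turn (a t) (b t) (c t) : ℝ)) =
      fun t => if t ∈ ({t | b t < a t} ∩ {t | c t < b t}) ∪
        ({t | b t < a t}ᶜ ∩ {t | c t < b t}ᶜ) then 0 else 1 := by
    ext t
    by_cases h : b t < a t <;> by_cases h' : c t < b t <;> simp [turn, h, h']
  rw [this]
  exact Measurable.ite ((h1.inter h2).union (h1.compl.inter h2.compl)) measurable_const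
    measurable_const

lemma measurable_descent {α : Type*} [MeasurableSpace α] {a b : α → ℝ} (ha : Measurable a)
    (hb : Measurable b) : Measurable fun t => (descent (a t) (b t) : ℝ) := by
  simp only [descent, Nat.cast_ite, Nat.cast_one, Nat.cast_zero]
  exact Measurable.ite (measurableSet_lt hb ha) measurable_const measurable_const

lemma turn_strictMono {Λ Λ' : Type*} [LinearOrder Λ] [LinearOrder Λ'] {h : Λ → Λ'}
    (hh : StrictMono h) (a b c : Λ) : turn (h a) (h b) (h c) = turn a b c := by
  simp only [turn, hh.lt_iff_lt]

lemma descent_strictMono {Λ Λ' : Type*} [LinearOrder Λ] [LinearOrder Λ'] {h : Λ → Λ'}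
    (hh : StrictMono h) (a b : Λ) : descent (h a) (h b) = descent a b := by
  simp only [descent, hh.lt_iff_lt]

/-- The indicator of a change of direction at `i + 1`. -/
noncomputable def turnAt (i : ℕ) (x : ℕ → ℝ) : ℝ := turn (x i) (x (i + 1)) (x (i + 2))

/-- The indicator of a descent at the first step. -/
noncomputable def firstDescent (x : ℕ → ℝ) : ℝ := descent (x 0) (x 1)

/-- The number of changes of direction among the first `m` interior positions. -/
noncomputable def turnSum (m : ℕ) (x : ℕ → ℝ) : ℝ := ∑ i ∈ Finset.range m, turnAt i x

@[fun_prop]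
lemma measurable_turnAt (i : ℕ) : Measurable (turnAt i) :=
  measurable_turn (by fun_prop) (by fun_prop) (by fun_prop)

@[fun_prop]
lemma measurable_firstDescent : Measurable firstDescent :=
  measurable_descent (by fun_prop) (by fun_prop)

@[fun_prop]
lemma measurable_turnSum (m : ℕ) : Measurable (turnSum m) := by
  unfold turnSum
  fun_prop

lemma turnAt_mem_Icc (i : ℕ) (x : ℕ → ℝ) : turnAt i x ∈ Set.Icc (0 : ℝ) 1 := by
  unfold turnAt turn
  split_ifs <;> simp

lemma firstDescent_mem_Icc (x : ℕ → ℝ) : firstDescent x ∈ Set.Icc (0 : ℝ) 1 := by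
  unfold firstDescent descent
  split_ifs <;> simp

lemma turnAt_sq (i : ℕ) (x : ℕ → ℝ) : turnAt i x ^ 2 = turnAt i x := by
  unfold turnAt turn
  split_ifs <;> simp

lemma firstDescent_sq (x : ℕ → ℝ) : firstDescent x ^ 2 = firstDescent x := by
  unfold firstDescent descent
  split_ifs <;> simp

lemma memLp_turnAt (i : ℕ) : MemLp (turnAt i) 2 iidGaussian :=
  memLp_of_bounded (ae_of_all _ (turnAt_mem_Icc i)) (by fun_prop) 2

lemma memLp_firstDescent : MemLp firstDescent 2 iidGaussian :=
  memLp_of_bounded (ae_of_all _ firstDescent_mem_Icc) (by fun_prop) 2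

lemma memLp_turnSum (m : ℕ) : MemLp (turnSum m) 2 iidGaussian :=
  memLp_finsetSum (Finset.range m) fun i _ => memLp_turnAt i

lemma altCount_succ_cast (x : ℕ → ℝ) (m : ℕ) :
    (altCount x (m + 1) : ℝ) = 1 + firstDescent x + turnSum m x := by
  rw [altCount_eq_sum]
  simp [firstDescent, turnSum, turnAt]

lemma integral_turnAt (i : ℕ) : ∫ x, turnAt i x ∂iidGaussian = 2 / 3 := by
  have h := integral_of_relativeOrder (k := 3) (e := fun j => i + j)
    (f := fun u => (turn (u 0) (u 1) (u 2) : ℝ))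
    (F := fun π => (turn (π 0) (π 1) (π 2) : ℕ))
    (fun a b hab => Fin.ext (by simpa using hab))
    (measurable_turn (by fun_prop) (by fun_prop) (by fun_prop))
    (fun h hh π => by simp only [Function.comp_apply, turn_strictMono hh])
  -- All orders of three values turn except the two monotone ones.
  have hs : ∑ π : Equiv.Perm (Fin 3), turn (π 0) (π 1) (π 2) = 4 := by decide +kernel
  rw [← Nat.cast_sum, hs] at h
  refine h.trans ?_
  norm_num [Nat.factorial]

lemma integral_turnAt_mul_succ (i : ℕ) :
    ∫ x, (turnAt i * turnAt (i + 1)) x ∂iidGaussian = 5 / 12 := by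
  have h := integral_of_relativeOrder (k := 4) (e := fun j => i + j)
    (f := fun u => (turn (u 0) (u 1) (u 2) : ℝ) * (turn (u 1) (u 2) (u 3) : ℝ))
    (F := fun π => (turn (π 0) (π 1) (π 2) * turn (π 1) (π 2) (π 3) : ℕ))
    (fun a b hab => Fin.ext (by simpa using hab))
    ((measurable_turn (by fun_prop) (by fun_prop) (by fun_prop)).mul
      (measurable_turn (by fun_prop) (by fun_prop) (by fun_prop)))
    (fun h hh π => by simp only [Function.comp_apply, turn_strictMono hh, Nat.cast_mul])
  -- Two consecutive turns mean that the four values alternate: five up-down and five down-up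
  -- orders.
  have hs : ∑ π : Equiv.Perm (Fin 4), turn (π 0) (π 1) (π 2) * turn (π 1) (π 2) (π 3) = 10 := by
    decide +kernel
  rw [← Nat.cast_sum, hs] at h
  refine h.trans ?_
  norm_num [Nat.factorial]

lemma integral_turnAt_mul_add_two (i : ℕ) :
    ∫ x, (turnAt i * turnAt (i + 2)) x ∂iidGaussian = 9 / 20 := by
  have h := integral_of_relativeOrder (k := 5) (e := fun j => i + j)
    (f := fun u => (turn (u 0) (u 1) (u 2) : ℝ) * (turn (u 2) (u 3) (u 4) : ℝ))
    (F := fun π => (turn (π 0) (π 1) (π 2) * turn (π 2) (π 3) (π 4) : ℕ))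
    (fun a b hab => Fin.ext (by simpa using hab))
    ((measurable_turn (by fun_prop) (by fun_prop) (by fun_prop)).mul
      (measurable_turn (by fun_prop) (by fun_prop) (by fun_prop)))
    (fun h hh π => by simp only [Function.comp_apply, turn_strictMono hh, Nat.cast_mul])
  have hs : ∑ π : Equiv.Perm (Fin 5), turn (π 0) (π 1) (π 2) * turn (π 2) (π 3) (π 4) = 54 := by
    decide +kernel
  rw [← Nat.cast_sum, hs] at h
  refine h.trans ?_
  norm_num [Nat.factorial]

lemma integral_firstDescent : ∫ x, firstDescent x ∂iidGaussian = 1 / 2 := by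
  have h := integral_of_relativeOrder (k := 2) (e := fun j => j)
    (f := fun u => (descent (u 0) (u 1) : ℝ))
    (F := fun π => (descent (π 0) (π 1) : ℕ))
    Fin.val_injective
    (measurable_descent (by fun_prop) (by fun_prop))
    (fun h hh π => by simp only [Function.comp_apply, descent_strictMono hh])
  have hs : ∑ π : Equiv.Perm (Fin 2), descent (π 0) (π 1) = 1 := by decide +kernel
  rw [← Nat.cast_sum, hs] at h
  refine h.trans ?_
  norm_num [Nat.factorial]

/-- Reversing the order of the values preserves turns and exchanges descents with ascents, so half
of the `80` turning permutations start with a descent. Five letters suffice for the three windows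
not covered by the independence of width-three windows. -/
lemma sum_descent_mul_turn : ∀ i : Fin 3, ∑ π : Equiv.Perm (Fin 5), descent (π 0) (π 1) *
    turn (π ⟨i, by omega⟩) (π ⟨i + 1, by omega⟩) (π ⟨i + 2, by omega⟩) = 40 := by
  decide +kernel

lemma integral_firstDescent_mul_turnAt {i : ℕ} (hi : i < 3) :
    ∫ x, (firstDescent * turnAt i) x ∂iidGaussian = 1 / 3 := by
  have hlt : ∀ j < 3, i + j < 5 := by omega
  have h := integral_of_relativeOrder (k := 5) (e := fun j => j)
    (f := fun u => (descent (u 0) (u 1) : ℝ) *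
      (turn (u ⟨i, hlt 0 (by omega)⟩) (u ⟨i + 1, hlt 1 (by omega)⟩)
        (u ⟨i + 2, hlt 2 (by omega)⟩) : ℝ))
    (F := fun π => (descent (π 0) (π 1) *
      turn (π ⟨i, hlt 0 (by omega)⟩) (π ⟨i + 1, hlt 1 (by omega)⟩)
        (π ⟨i + 2, hlt 2 (by omega)⟩) : ℕ))
    Fin.val_injective
    ((measurable_descent (by fun_prop) (by fun_prop)).mul
      (measurable_turn (by fun_prop) (by fun_prop) (by fun_prop)))
    (fun h hh π => by
      simp only [Function.comp_apply, turn_strictMono hh, descent_strictMono hh, Nat.cast_mul])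
  rw [← Nat.cast_sum, sum_descent_mul_turn ⟨i, hi⟩] at h
  refine h.trans ?_
  norm_num [Nat.factorial]

/-! ### Covariances, exact mean and exact variance -/

lemma covariance_turnAt_succ (i : ℕ) : cov[turnAt i, turnAt (i + 1); iidGaussian] = -1 / 36 := by
  rw [covariance_eq_sub (memLp_turnAt _) (memLp_turnAt _), integral_turnAt_mul_succ,
    integral_turnAt, integral_turnAt]
  norm_num

lemma covariance_turnAt_add_two (i : ℕ) :
    cov[turnAt i, turnAt (i + 2); iidGaussian] = 1 / 180 := by
  rw [covariance_eq_sub (memLp_turnAt _) (memLp_turnAt _), integral_turnAt_mul_add_two,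
    integral_turnAt, integral_turnAt]
  norm_num

lemma covariance_turnAt_of_le {i j : ℕ} (hij : i + 3 ≤ j) :
    cov[turnAt i, turnAt j; iidGaussian] = 0 := by
  have hm : Measurable fun u : Fin 3 → ℝ => (turn (u 0) (u 1) (u 2) : ℝ) :=
    measurable_turn (by fun_prop) (by fun_prop) (by fun_prop)
  exact (indepFun_blocks hij hm hm).covariance_eq_zero (memLp_turnAt i) (memLp_turnAt j)

lemma covariance_firstDescent_turnAt (i : ℕ) :
    cov[firstDescent, turnAt i; iidGaussian] = 0 := by
  rcases lt_or_ge i 3 with hi | hi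
  · rw [covariance_eq_sub memLp_firstDescent (memLp_turnAt _), integral_firstDescent_mul_turnAt hi,
      integral_firstDescent, integral_turnAt]
    norm_num
  · have hm : Measurable fun u : Fin 3 → ℝ => (turn (u 0) (u 1) (u 2) : ℝ) :=
      measurable_turn (by fun_prop) (by fun_prop) (by fun_prop)
    have hd : Measurable fun u : Fin 3 → ℝ => (descent (u 0) (u 1) : ℝ) :=
      measurable_descent (by fun_prop) (by fun_prop)
    refine (indepFun_blocks (a := 0) (b := i) (by omega) hd hm).covariance_eq_zero
      ?_ (memLp_turnAt i)
    simp only [zero_add]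
    exact memLp_firstDescent

lemma variance_turnAt (i : ℕ) : Var[turnAt i; iidGaussian] = 2 / 9 := by
  rw [variance_eq_sub (memLp_turnAt i)]
  have : turnAt i ^ 2 = turnAt i := funext (turnAt_sq i)
  rw [this, integral_turnAt]
  norm_num

lemma variance_firstDescent : Var[firstDescent; iidGaussian] = 1 / 4 := by
  rw [variance_eq_sub memLp_firstDescent]
  have : firstDescent ^ 2 = firstDescent := funext firstDescent_sq
  rw [this, integral_firstDescent]
  norm_num

lemma integral_turnSum (m : ℕ) : ∫ x, turnSum m x ∂iidGaussian = 2 * m / 3 := by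
  unfold turnSum
  rw [integral_finsetSum _ fun i _ => (memLp_turnAt i).integrable (by norm_num)]
  simp [integral_turnAt]
  ring

lemma turnSum_succ (m : ℕ) : turnSum (m + 1) = turnSum m + turnAt m := by
  ext x
  exact Finset.sum_range_succ _ _

lemma covariance_turnSum_turnAt {m j : ℕ} (h : m + 2 ≤ j) :
    cov[turnSum m, turnAt j; iidGaussian] = 0 := by
  unfold turnSum
  rw [covariance_fun_sum_left' (fun i _ => memLp_turnAt i) (memLp_turnAt j)]
  refine Finset.sum_eq_zero fun i hi => covariance_turnAt_of_le ?_
  have := Finset.mem_range.1 hi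
  omega

/-- Only the two preceding turns correlate with a new one: `-1/36 + 1/180 = -1/45`. -/
lemma covariance_turnSum_turnAt_self (m : ℕ) :
    cov[turnSum (m + 2), turnAt (m + 2); iidGaussian] = -1 / 45 := by
  rw [turnSum_succ, turnSum_succ, covariance_add_left, covariance_add_left,
    covariance_turnSum_turnAt le_rfl, covariance_turnAt_add_two, covariance_turnAt_succ]
  · norm_num
  all_goals first
    | exact memLp_turnSum _
    | exact memLp_turnAt _
    | exact (memLp_turnSum _).add (memLp_turnAt _)

/-- Each further turn adds `2/9 - 2/45 = 8/45`. The induction starts at two turns, from where every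
new turn has both of its correlated predecessors. -/
lemma variance_turnSum (m : ℕ) :
    Var[turnSum (m + 2); iidGaussian] = 8 * ((m : ℝ) + 2) / 45 + 1 / 30 := by
  induction m with
  | zero =>
    rw [turnSum_succ, turnSum_succ, variance_add ((memLp_turnSum 0).add (memLp_turnAt 0))
      (memLp_turnAt _)]
    have : turnSum 0 + turnAt 0 = turnAt 0 := by ext x; simp [turnSum]
    rw [this, variance_turnAt, variance_turnAt, covariance_turnAt_succ]
    norm_num
  | succ m ih =>
    rw [turnSum_succ, variance_add (memLp_turnSum _) (memLp_turnAt _), ih, variance_turnAt,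
      covariance_turnSum_turnAt_self]
    push_cast
    ring

lemma integral_altCount (m : ℕ) :
    ∫ x, (altCount x (m + 1) : ℝ) ∂iidGaussian = 2 * ((m : ℝ) + 2) / 3 + 1 / 6 := by
  simp only [altCount_succ_cast]
  have h1 := memLp_firstDescent.integrable (by norm_num)
  have h2 := (memLp_turnSum m).integrable (by norm_num)
  have h3 : Integrable (fun x => 1 + firstDescent x) iidGaussian := (integrable_const _).add h1
  rw [integral_add h3 h2, integral_add (integrable_const _) h1,
    integral_turnSum, integral_firstDescent]
  simp
  ring

lemma variance_altCount (m : ℕ) :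
    Var[fun x => (altCount x (m + 3) : ℝ); iidGaussian] = 8 * ((m : ℝ) + 4) / 45 - 13 / 180 := by
  have : (fun x => (altCount x (m + 3) : ℝ)) =
      fun x => 1 + (firstDescent + turnSum (m + 2)) x := by
    ext x
    rw [altCount_succ_cast, Pi.add_apply, add_assoc]
  have hc : cov[firstDescent, turnSum (m + 2); iidGaussian] = 0 := by
    unfold turnSum
    rw [covariance_fun_sum_right' (fun i _ => memLp_turnAt i) memLp_firstDescent]
    exact Finset.sum_eq_zero fun i _ => covariance_firstDescent_turnAt i
  rw [this, variance_const_add (by fun_prop),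
    variance_add memLp_firstDescent (memLp_turnSum _), hc, variance_firstDescent, variance_turnSum]
  ring

/-! ### Characteristic functions and `L¹` estimates -/

/-- Since `θ ↦ exp (iθ)` is `1`-Lipschitz, an `L¹` approximation of random variables yields a
pointwise one of characteristic functions. -/
lemma norm_charFun_map_sub_le {Ω : Type*} [MeasurableSpace Ω] {P : Measure Ω}
    [IsProbabilityMeasure P] {X Y : Ω → ℝ} (hX : AEMeasurable X P) (hY : AEMeasurable Y P)
    (hXY : Integrable (fun ω => X ω - Y ω) P) (t : ℝ) :
    ‖charFun (P.map X) t - charFun (P.map Y) t‖ ≤ |t| * ∫ ω, |X ω - Y ω| ∂P := by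
  have hint : ∀ Z : Ω → ℝ, AEMeasurable Z P →
      Integrable (fun ω => Complex.exp (t * Z ω * Complex.I)) P := by
    intro Z hZ
    refine Integrable.of_bound (C := 1) ?_ (ae_of_all _ fun ω => ?_)
    · exact (by fun_prop : AEMeasurable _ P).aestronglyMeasurable
    · rw [← Complex.ofReal_mul, Complex.norm_exp_ofReal_mul_I]
  have hchar : ∀ Z : Ω → ℝ, AEMeasurable Z P →
      charFun (P.map Z) t = ∫ ω, Complex.exp (t * Z ω * Complex.I) ∂P := by
    intro Z hZ
    rw [charFun_apply_real, integral_map hZ]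
    exact (by fun_prop : Measurable fun x : ℝ =>
      Complex.exp (t * x * Complex.I)).aestronglyMeasurable
  rw [hchar X hX, hchar Y hY, ← integral_sub (hint X hX) (hint Y hY), ← integral_const_mul]
  refine (norm_integral_le_integral_norm _).trans ?_
  refine integral_mono (((hint X hX).sub (hint Y hY)).norm) (hXY.abs.const_mul _) fun ω => ?_
  have hfac : Complex.exp (t * X ω * Complex.I) - Complex.exp (t * Y ω * Complex.I) =
      Complex.exp (((t * Y ω : ℝ) : ℂ) * Complex.I) *
        (Complex.exp (Complex.I * ((t * (X ω - Y ω) : ℝ) : ℂ)) - 1) := by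
    rw [mul_sub, ← Complex.exp_add, mul_one]
    push_cast
    ring_nf
  simp only [hfac, norm_mul, Complex.norm_exp_ofReal_mul_I, one_mul]
  refine Real.norm_exp_I_mul_ofReal_sub_one_le.trans ?_
  rw [Real.norm_eq_abs, abs_mul]

/-- An `ε/3` argument for the double limit: `n → ∞` at fixed block parameter `q`, then `q → ∞`. -/
lemma tendsto_of_approx {f : ℕ → ℂ} {h : ℕ → ℕ → ℂ} {L : ℂ} {l : ℕ → ℂ} {β : ℕ → ℝ}
    {c : ℕ → ℕ → ℝ} (hfh : ∀ q, ∀ᶠ n in atTop, ‖f n - h q n‖ ≤ c q n)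
    (hc : ∀ q, Tendsto (c q) atTop (nhds (β q))) (hβ : Tendsto β atTop (nhds 0))
    (hh : ∀ q, Tendsto (h q) atTop (nhds (l q))) (hl : Tendsto l atTop (nhds L)) :
    Tendsto f atTop (nhds L) := by
  rw [Metric.tendsto_nhds]
  intro ε hε
  obtain ⟨q, hq1, hq2⟩ := ((hβ.eventually (gt_mem_nhds (show 0 < ε / 3 by positivity))).and
    (Metric.tendsto_nhds.1 hl (ε / 3) (by positivity))).exists
  filter_upwards [hfh q, (hc q).eventually (gt_mem_nhds hq1),
    Metric.tendsto_nhds.1 (hh q) (ε / 3) (by positivity)] with n h1 h2 h3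
  rw [← dist_eq_norm] at h1
  linarith [dist_triangle (f n) (h q n) L, dist_triangle (h q n) (l q) L]

lemma integral_abs_le_sqrt_variance {Ω : Type*} [MeasurableSpace Ω] {P : Measure Ω}
    [IsProbabilityMeasure P] {X : Ω → ℝ} (hX : MemLp X 2 P) (h0 : ∫ ω, X ω ∂P = 0) :
    ∫ ω, |X ω| ∂P ≤ √Var[X; P] := by
  refine Real.le_sqrt_of_sq_le ?_
  have h1 := variance_nonneg (fun ω => |X ω|) P
  have h2 : MemLp (fun ω => |X ω|) 2 P := hX.abs
  rw [variance_eq_sub h2] at h1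
  rw [variance_of_integral_eq_zero hX.aestronglyMeasurable.aemeasurable h0]
  simp only [Pi.pow_apply, sq_abs] at h1
  linarith

/-- Independence makes the variance of the sum linear in `N`, so its `L¹` norm is of order `√N`;
this is what makes the gaps negligible. -/
lemma integral_abs_sum_le {Ω : Type*} [MeasurableSpace Ω] {P : Measure Ω}
    [IsProbabilityMeasure P] {X : ℕ → Ω → ℝ} (hindep : iIndepFun X P)
    (hident : ∀ i, IdentDistrib (X i) (X 0) P P) (hX : MemLp (X 0) 2 P)
    (h0 : ∫ ω, X 0 ω ∂P = 0) (N : ℕ) :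
    ∫ ω, |∑ i ∈ Finset.range N, X i ω| ∂P ≤ √(N * Var[X 0; P]) := by
  have hL : ∀ i, MemLp (X i) 2 P := fun i => (hident i).memLp_iff.2 hX
  have hv : Var[∑ i ∈ Finset.range N, X i; P] = N * Var[X 0; P] := by
    rw [IndepFun.variance_sum (fun i _ => hL i) fun i _ j _ hij => hindep.indepFun hij]
    simp [fun i => (hident i).variance_eq]
  rw [← hv]
  convert integral_abs_le_sqrt_variance (memLp_finsetSum' (Finset.range N) fun i _ => hL i) ?_
    using 3 with ω
  · rw [Finset.sum_apply]
  · simp only [Finset.sum_apply]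
    rw [integral_finsetSum _ fun i _ => (hL i).integrable (by norm_num)]
    exact Finset.sum_eq_zero fun i _ => by rw [(hident i).integral_eq, h0]

/-! ### Shifts and the block decomposition -/

lemma iIndepFun_shift {w : ℕ} {f : (ℕ → ℝ) → ℝ} (hf : Measurable f)
    (hfw : ∀ x y : ℕ → ℝ, (∀ i < w, x i = y i) → f x = f y) {a : ℕ → ℕ}
    (ha : ∀ b, a b + w ≤ a (b + 1)) :
    iIndepFun (fun (b : ℕ) (x : ℕ → ℝ) => f fun n => x (a b + n)) iidGaussian := by
  have hmono : Monotone a := monotone_nat_of_le_succ fun b => by have := ha b; omega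
  have hlt : ∀ b c, b < c → a b + w ≤ a c := fun b c hbc => (ha b).trans (hmono hbc)
  have h := iIndepFun_blocks (e := fun (b : ℕ) (j : Fin w) => a b + j) (by
    rintro ⟨b, i⟩ ⟨c, j⟩ hij
    have hi := i.2
    have hj := j.2
    dsimp only at hij
    rcases lt_trichotomy b c with hbc | rfl | hbc
    · have := hlt b c hbc
      omega
    · simp only [Prod.mk.injEq, true_and]
      omega
    · have := hlt c b hbc
      omega)
  -- A window of width `w` is padded with zeros to a full sequence; `f` does not see the padding.
  have h2 := h.comp (fun _ u => f fun n => if hn : n < w then u ⟨n, hn⟩ else 0) fun _ =>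
    hf.comp (measurable_pi_lambda _ fun n => by split_ifs <;> fun_prop)
  refine (iIndepFun_congr fun b => ae_of_all _ fun x => ?_).1 h2
  exact hfw _ _ fun i hi => by simp [hi]

lemma identDistrib_shift {f : (ℕ → ℝ) → ℝ} (hf : Measurable f) (a b : ℕ) :
    IdentDistrib (fun x : ℕ → ℝ => f fun n => x (a + n)) (fun x : ℕ → ℝ => f fun n => x (b + n))
      iidGaussian iidGaussian := by
  have h : IdentDistrib (fun (x : ℕ → ℝ) n => x (a + n)) (fun (x : ℕ → ℝ) n => x (b + n))
      iidGaussian iidGaussian :=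
    ⟨Measurable.aemeasurable (by fun_prop), Measurable.aemeasurable (by fun_prop), by
      rw [iidGaussian_map_injective fun i j hij => by simpa using hij,
        iidGaussian_map_injective fun i j hij => by simpa using hij]⟩
  exact h.comp hf

lemma turnAt_congr {i : ℕ} {x y : ℕ → ℝ} (h : ∀ j < i + 3, x j = y j) :
    turnAt i x = turnAt i y := by
  unfold turnAt
  rw [h i (by omega), h (i + 1) (by omega), h (i + 2) (by omega)]

lemma turnSum_congr {m : ℕ} {x y : ℕ → ℝ} (h : ∀ j < m + 2, x j = y j) :
    turnSum m x = turnSum m y :=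
  Finset.sum_congr rfl fun i hi => turnAt_congr fun j hj => h j (by
    have := Finset.mem_range.1 hi
    omega)

/-- The centered number of changes of direction among the first `m` interior positions. -/
noncomputable def centeredTurnSum (m : ℕ) (x : ℕ → ℝ) : ℝ := turnSum m x - 2 * m / 3

@[fun_prop]
lemma measurable_centeredTurnSum (m : ℕ) : Measurable (centeredTurnSum m) := by
  unfold centeredTurnSum
  fun_prop

lemma centeredTurnSum_add (a m : ℕ) (x : ℕ → ℝ) :
    centeredTurnSum (a + m) x = centeredTurnSum a x + centeredTurnSum m fun n => x (a + n) := by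
  have : turnSum (a + m) x = turnSum a x + turnSum m fun n => x (a + n) :=
    Finset.sum_range_add _ _ _
  rw [centeredTurnSum, centeredTurnSum, centeredTurnSum, this]
  push_cast
  ring

lemma centeredTurnSum_congr {m : ℕ} {x y : ℕ → ℝ} (h : ∀ j < m + 2, x j = y j) :
    centeredTurnSum m x = centeredTurnSum m y := by
  rw [centeredTurnSum, centeredTurnSum, turnSum_congr h]

lemma abs_centeredTurnSum_le (m : ℕ) (x : ℕ → ℝ) : |centeredTurnSum m x| ≤ m := by
  have h1 : 0 ≤ turnSum m x := Finset.sum_nonneg fun i _ => (turnAt_mem_Icc i x).1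
  have h2 : turnSum m x ≤ m := by
    refine (Finset.sum_le_card_nsmul _ _ 1 fun i _ => (turnAt_mem_Icc i x).2).trans ?_
    simp
  have h3 : (0 : ℝ) ≤ m := m.cast_nonneg
  rw [centeredTurnSum, abs_le]
  constructor <;> linarith

lemma abs_centeredTurnSum_sub_le {m m' d : ℕ} (h1 : m ≤ m' + d) (h2 : m' ≤ m + d) (x : ℕ → ℝ) :
    |centeredTurnSum m x - centeredTurnSum m' x| ≤ d := by
  wlog hle : m' ≤ m generalizing m m'
  · rw [abs_sub_comm]
    exact this h2 h1 (by omega)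
  obtain ⟨e, rfl⟩ := Nat.exists_eq_add_of_le hle
  rw [centeredTurnSum_add, add_sub_cancel_left]
  exact (abs_centeredTurnSum_le _ _).trans (by exact_mod_cast (by omega))

lemma memLp_centeredTurnSum (m : ℕ) : MemLp (centeredTurnSum m) 2 iidGaussian :=
  (memLp_turnSum m).sub (memLp_const _)

lemma integral_centeredTurnSum (m : ℕ) : ∫ x, centeredTurnSum m x ∂iidGaussian = 0 := by
  unfold centeredTurnSum
  rw [integral_sub ((memLp_turnSum m).integrable (by norm_num)) (integrable_const _),
    integral_turnSum]
  simp

lemma variance_centeredTurnSum (m : ℕ) :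
    Var[centeredTurnSum (m + 2); iidGaussian] = 8 * ((m : ℝ) + 2) / 45 + 1 / 30 := by
  rw [← variance_turnSum]
  exact variance_sub_const (by fun_prop) _

/-- The centered number of changes of direction inside the `b`-th block of length `q + 4`. -/
noncomputable def blockSum (q b : ℕ) (x : ℕ → ℝ) : ℝ :=
  centeredTurnSum (q + 2) fun n => x (b * (q + 4) + n)

/-- The centered number of changes of direction at the two positions which straddle the `b`-th
block of length `q + 4` and the next one. -/
noncomputable def gapSum (q b : ℕ) (x : ℕ → ℝ) : ℝ :=
  centeredTurnSum 2 fun n => x (b * (q + 4) + (q + 2) + n)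

@[fun_prop]
lemma measurable_blockSum (q b : ℕ) : Measurable (blockSum q b) :=
  (measurable_centeredTurnSum _).comp (by fun_prop)

/-- A turn reads three consecutive entries, so a block of `q + 4` entries contains `q + 2` turns of
its own. The remaining two read four entries around the boundary, and these windows are again
disjoint for different `b`. -/
lemma centeredTurnSum_eq_blocks (q N : ℕ) (x : ℕ → ℝ) :
    centeredTurnSum (N * (q + 4)) x =
      ∑ b ∈ Finset.range N, blockSum q b x + ∑ b ∈ Finset.range N, gapSum q b x := by
  induction N with
  | zero => simp [centeredTurnSum, turnSum]
  | succ N ih =>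
    rw [Finset.sum_range_succ, Finset.sum_range_succ,
      show (N + 1) * (q + 4) = N * (q + 4) + (q + 2) + 2 by ring, centeredTurnSum_add,
      centeredTurnSum_add, ih, blockSum, gapSum]
    ring

lemma iIndepFun_blockSum (q : ℕ) : iIndepFun (blockSum q) iidGaussian :=
  iIndepFun_shift (w := q + 4) (measurable_centeredTurnSum _)
    (fun _ _ h => centeredTurnSum_congr h) (fun b => by rw [add_mul, one_mul])

lemma iIndepFun_gapSum (q : ℕ) : iIndepFun (gapSum q) iidGaussian :=
  iIndepFun_shift (w := 4) (measurable_centeredTurnSum _)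
    (fun _ _ h => centeredTurnSum_congr h) (fun b => by rw [add_mul]; omega)

lemma identDistrib_blockSum (q b : ℕ) :
    IdentDistrib (blockSum q b) (blockSum q 0) iidGaussian iidGaussian :=
  identDistrib_shift (measurable_centeredTurnSum _) _ _

lemma identDistrib_gapSum (q b : ℕ) :
    IdentDistrib (gapSum q b) (gapSum q 0) iidGaussian iidGaussian :=
  identDistrib_shift (measurable_centeredTurnSum _) _ _

lemma blockSum_zero (q : ℕ) : blockSum q 0 = centeredTurnSum (q + 2) := by
  ext x
  simp [blockSum]

lemma identDistrib_gapSum_zero (q : ℕ) :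
    IdentDistrib (gapSum q 0) (centeredTurnSum 2) iidGaussian iidGaussian := by
  have h := identDistrib_shift (measurable_centeredTurnSum 2) (0 * (q + 4) + (q + 2)) 0
  simp only [zero_add] at h
  exact h

/-! ### The central limit theorem -/

lemma tendsto_charFun_blockSum (q : ℕ) (s : ℝ) :
    Tendsto (fun N : ℕ => charFun (iidGaussian.map fun x =>
        (√N)⁻¹ * ∑ b ∈ Finset.range N, blockSum q b x) s) atTop
      (nhds (Complex.exp (-((8 * ((q : ℝ) + 2) / 45 + 1 / 30) * s ^ 2 / 2 : ℝ)))) := by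
  have hL : MemLp (blockSum q 0) 2 iidGaussian := blockSum_zero q ▸ memLp_centeredTurnSum _
  have h0 : ∫ x, blockSum q 0 x ∂iidGaussian = 0 := by
    rw [blockSum_zero, integral_centeredTurnSum]
  have hv : Var[blockSum q 0; iidGaussian] = 8 * ((q : ℝ) + 2) / 45 + 1 / 30 := by
    rw [blockSum_zero, variance_centeredTurnSum]
  have h := tendstoInDistribution_inv_sqrt_mul_sum_sub
    (P' := gaussianReal 0 Var[blockSum q 0; iidGaussian].toNNReal) (Y := id)
    ⟨aemeasurable_id, Measure.map_id⟩ hL (iIndepFun_blockSum q) (identDistrib_blockSum q)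
  have h' := ProbabilityMeasure.tendsto_iff_tendsto_charFun.1 h.tendsto s
  simp only [ProbabilityMeasure.coe_mk, Measure.map_id, charFun_gaussianReal, h0, mul_zero,
    sub_zero, hv] at h'
  convert h' using 3
  rw [Real.coe_toNNReal _ (by positivity)]
  push_cast
  simp

lemma tendsto_sqrt_div_mul (K : ℕ) (hK : 0 < K) :
    Tendsto (fun n : ℕ => √((n / K : ℕ) : ℝ) / √(8 * n / 45)) atTop
      (nhds √(45 / (8 * K))) := by
  have hK' : (0 : ℝ) < K := by exact_mod_cast hK
  have h1 : Tendsto (fun n : ℕ => ((n / K : ℕ) : ℝ) / n) atTop (nhds (1 / K)) := by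
    have h2 : Tendsto (fun n : ℕ => (1 : ℝ) / K - 1 / n) atTop (nhds (1 / K)) := by
      simpa using tendsto_const_nhds.sub (tendsto_one_div_atTop_nhds_zero_nat (𝕜 := ℝ))
    refine tendsto_of_tendsto_of_tendsto_of_le_of_le' h2 tendsto_const_nhds ?_ ?_
    · filter_upwards [eventually_gt_atTop 0] with n hn
      have hn' : (0 : ℝ) < n := by exact_mod_cast hn
      have : (n : ℝ) < ((n / K : ℕ) + 1) * K := by
        exact_mod_cast (Nat.lt_mul_of_div_lt (Nat.lt_succ_self _) hK)
      rw [le_div_iff₀ hn', sub_mul, div_mul_cancel₀ _ hn'.ne', sub_le_iff_le_add, one_div,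
        inv_mul_le_iff₀ hK']
      linarith
    · filter_upwards [eventually_gt_atTop 0] with n hn
      have hn' : (0 : ℝ) < n := by exact_mod_cast hn
      rw [div_le_iff₀ hn', one_div, inv_mul_eq_div]
      exact Nat.cast_div_le
  have h3 := ((h1.const_mul (45 / 8)).sqrt)
  refine (h3.congr fun n => ?_).trans_eq ?_
  · rw [← Real.sqrt_div (Nat.cast_nonneg _)]
    congr 1
    rw [div_div_eq_mul_div]
    ring
  · congr 2
    field_simp

/-- The normalized length of the longest alternating subsequence of `x 0, …, x (n - 1)`. -/
noncomputable def normalizedCount (n : ℕ) (x : ℕ → ℝ) : ℝ :=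
  ((altCount x (n - 1) : ℝ) - 2 * n / 3) / √(8 * n / 45)

/-- The three errors come from the incomplete last block together with the first step, from the
gaps, and from replacing the normalization by `c`. -/
lemma abs_normalizedCount_sub_le (q : ℕ) {n : ℕ} (hn : 2 ≤ n) (c : ℝ) (x : ℕ → ℝ) :
    |normalizedCount n x - c * ∑ b ∈ Finset.range (n / (q + 4)), blockSum q b x| ≤
      ((q : ℝ) + 6) / √(8 * n / 45) +
      |∑ b ∈ Finset.range (n / (q + 4)), gapSum q b x| / √(8 * n / 45) +
      |∑ b ∈ Finset.range (n / (q + 4)), blockSum q b x| * |1 / √(8 * n / 45) - c| := by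
  obtain ⟨m, rfl⟩ : ∃ m, n = m + 2 := ⟨n - 2, by omega⟩
  set N := (m + 2) / (q + 4)
  have hs : 0 < √(8 * ((m + 2 : ℕ) : ℝ) / 45) := Real.sqrt_pos.2 (by positivity)
  set s := √(8 * ((m + 2 : ℕ) : ℝ) / 45)
  have hblocks := centeredTurnSum_eq_blocks q N x
  set T := ∑ b ∈ Finset.range N, blockSum q b x
  set R := ∑ b ∈ Finset.range N, gapSum q b x
  have h1 : N * (q + 4) ≤ m + 2 := Nat.div_mul_le_self _ _
  have h2 : m + 2 < (N + 1) * (q + 4) := Nat.lt_mul_of_div_lt (Nat.lt_succ_self _) (by omega)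
  have h3 := abs_centeredTurnSum_sub_le (m := m) (m' := N * (q + 4)) (d := q + 4)
    (by linarith) (by omega) x
  have h4 := firstDescent_mem_Icc x
  -- Centering at `2(m + 2)/3` rather than `2m/3` turns `1 + firstDescent` into `firstDescent -
  -- 1/3`, of absolute value at most `2/3`; with the `q + 4` of `h3` this stays below `q + 6`.
  have hA : normalizedCount (m + 2) x - c * T =
      ((firstDescent x - 1 / 3) + (centeredTurnSum m x - centeredTurnSum (N * (q + 4)) x)) / s +
        R / s + T * (1 / s - c) := by
    change ((altCount x (m + 1) : ℝ) - 2 * ((m + 2 : ℕ) : ℝ) / 3) / s - c * T = _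
    rw [altCount_succ_cast, hblocks, centeredTurnSum]
    push_cast
    field_simp
    ring
  rw [hA]
  refine (abs_add_le _ _).trans (add_le_add ((abs_add_le _ _).trans (add_le_add ?_ ?_)) ?_)
  · rw [abs_div, abs_of_pos hs]
    gcongr
    push_cast at h3
    rw [abs_le] at h3 ⊢
    constructor <;> linarith [h4.1, h4.2]
  · rw [abs_div, abs_of_pos hs]
  · rw [abs_mul]

lemma memLp_altCount (m : ℕ) : MemLp (fun x => (altCount x (m + 1) : ℝ)) 2 iidGaussian := by
  simp only [altCount_succ_cast]
  have h : MemLp (fun x => 1 + firstDescent x) 2 iidGaussian :=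
    (memLp_const (1 : ℝ)).add memLp_firstDescent
  exact h.add (memLp_turnSum m)

lemma norm_charFun_normalizedCount_sub_le (q : ℕ) {n : ℕ} (hn : 2 ≤ n) (c t : ℝ) :
    ‖charFun (iidGaussian.map (normalizedCount n)) t -
        charFun (iidGaussian.map fun x => c *
          ∑ b ∈ Finset.range (n / (q + 4)), blockSum q b x) t‖ ≤
      |t| * (((q : ℝ) + 6) / √(8 * n / 45) +
        √((n / (q + 4) : ℕ) * Var[centeredTurnSum 2; iidGaussian]) / √(8 * n / 45) +
        √((n / (q + 4) : ℕ) * (8 * ((q : ℝ) + 2) / 45 + 1 / 30)) * |1 / √(8 * n / 45) - c|) := by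
  obtain ⟨m, rfl⟩ : ∃ m, n = m + 2 := ⟨n - 2, by omega⟩
  have hblock : ∀ b, MemLp (blockSum q b) 2 iidGaussian := fun b =>
    (identDistrib_blockSum q b).memLp_iff.2 (blockSum_zero q ▸ memLp_centeredTurnSum _)
  have hgap : ∀ b, MemLp (gapSum q b) 2 iidGaussian := fun b =>
    (identDistrib_gapSum q b).memLp_iff.2
      ((identDistrib_gapSum_zero q).memLp_iff.2 (memLp_centeredTurnSum _))
  have hT := integral_abs_sum_le (iIndepFun_blockSum q) (identDistrib_blockSum q) (hblock 0)
    (by rw [blockSum_zero, integral_centeredTurnSum]) ((m + 2) / (q + 4))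
  rw [blockSum_zero, variance_centeredTurnSum] at hT
  have hR := integral_abs_sum_le (iIndepFun_gapSum q) (identDistrib_gapSum q) (hgap 0)
    (by rw [(identDistrib_gapSum_zero q).integral_eq, integral_centeredTurnSum])
    ((m + 2) / (q + 4))
  rw [(identDistrib_gapSum_zero q).variance_eq] at hR
  have hTint : Integrable (fun x => ∑ b ∈ Finset.range ((m + 2) / (q + 4)), blockSum q b x)
      iidGaussian := integrable_finsetSum _ fun b _ => (hblock b).integrable (by norm_num)
  have hRint : Integrable (fun x => ∑ b ∈ Finset.range ((m + 2) / (q + 4)), gapSum q b x)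
      iidGaussian := integrable_finsetSum _ fun b _ => (hgap b).integrable (by norm_num)
  have hAint : Integrable (normalizedCount (m + 2)) iidGaussian :=
    (((memLp_altCount m).integrable (by norm_num)).sub (integrable_const _)).div_const _
  refine (norm_charFun_map_sub_le hAint.aemeasurable (hTint.const_mul c).aemeasurable
    (hAint.sub (hTint.const_mul c)) t).trans ?_
  refine mul_le_mul_of_nonneg_left ?_ (abs_nonneg t)
  refine (integral_mono (hAint.sub (hTint.const_mul c)).abs
    (((integrable_const _).add (hRint.abs.div_const _)).add (hTint.abs.mul_const _))
    fun x => abs_normalizedCount_sub_le q hn c x).trans ?_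
  have h1 : Integrable (fun x : ℕ → ℝ => ((q : ℝ) + 6) / √(8 * ((m + 2 : ℕ) : ℝ) / 45) +
      |∑ b ∈ Finset.range ((m + 2) / (q + 4)), gapSum q b x| / √(8 * ((m + 2 : ℕ) : ℝ) / 45))
      iidGaussian := (integrable_const _).add (hRint.abs.div_const _)
  simp only [Pi.add_apply]
  rw [integral_add h1 (hTint.abs.mul_const _),
    integral_add (integrable_const _) (hRint.abs.div_const _), integral_const, probReal_univ,
    one_smul, integral_div, integral_mul_const]
  gcongr

lemma tendsto_charFun_normalizedCount (t : ℝ) :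
    Tendsto (fun n => charFun (iidGaussian.map (normalizedCount n)) t) atTop
      (nhds (Complex.exp (-(t ^ 2 / 2 : ℝ)))) := by
  set v : ℕ → ℝ := fun q => 8 * ((q : ℝ) + 2) / 45 + 1 / 30
  -- The limit of `√N / √(8n/45)` for `N = n / (q + 4)`, so that `c q / √N` stands in for the true
  -- normalization.
  set c : ℕ → ℝ := fun q => √(45 / (8 * (q + 4 : ℕ)))
  set w := Var[centeredTurnSum 2; iidGaussian]
  have hs : Tendsto (fun n : ℕ => √(8 * (n : ℝ) / 45)) atTop atTop := by
    refine Real.tendsto_sqrt_atTop.comp (Tendsto.atTop_div_const (by norm_num) ?_)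
    exact tendsto_natCast_atTop_atTop.const_mul_atTop (by norm_num)
  have hc2 : ∀ q, c q ^ 2 = 45 / (8 * ((q : ℝ) + 4)) := fun q => by
    rw [Real.sq_sqrt (by positivity)]
    push_cast
    rfl
  have hinv : Tendsto (fun q : ℕ => ((q : ℝ) + 4)⁻¹) atTop (nhds 0) :=
    tendsto_inv_atTop_zero.comp (tendsto_atTop_add_const_right _ _ tendsto_natCast_atTop_atTop)
  refine tendsto_of_approx (l := fun q => Complex.exp (-(v q * (c q * t) ^ 2 / 2 : ℝ)))
    (β := fun q => |t| * (0 + c q * √w + √(v q) * |c q - c q * 1|))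
    (h := fun q n => charFun (iidGaussian.map fun x => (c q * (√((n / (q + 4) : ℕ) : ℝ))⁻¹) *
      ∑ b ∈ Finset.range (n / (q + 4)), blockSum q b x) t)
    (fun q => (eventually_ge_atTop 2).mono fun n hn =>
      norm_charFun_normalizedCount_sub_le q hn (c q * (√((n / (q + 4) : ℕ) : ℝ))⁻¹) t)
    (fun q => ?_) ?_ (fun q => ?_) ?_
  · have hN : Tendsto (fun n : ℕ => n / (q + 4)) atTop atTop :=
      Nat.tendsto_div_const_atTop (by omega)
    have hr := tendsto_sqrt_div_mul (q + 4) (by omega)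
    have h1 : Tendsto (fun n : ℕ => √((n / (q + 4) : ℕ) : ℝ) * (√((n / (q + 4) : ℕ) : ℝ))⁻¹) atTop
        (nhds 1) := by
      refine tendsto_const_nhds.congr' ?_
      filter_upwards [hN.eventually (eventually_gt_atTop 0)] with n hn
      rw [mul_inv_cancel₀]
      exact (Real.sqrt_pos.2 (by exact_mod_cast hn)).ne'
    refine Tendsto.const_mul _ (Tendsto.add (Tendsto.add ?_ ?_) ?_)
    · exact hs.const_div_atTop _
    · refine (hr.mul_const √w).congr fun n => ?_
      rw [Real.sqrt_mul (Nat.cast_nonneg _)]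
      ring
    -- With `√N` moved inside the absolute value, both terms of the difference tend to `c q`, and
    -- the normalization error vanishes.
    · refine ((hr.sub (h1.const_mul (c q))).abs.const_mul √(v q)).congr fun n => ?_
      rw [Real.sqrt_mul (Nat.cast_nonneg _), mul_comm (√((n / (q + 4) : ℕ) : ℝ)) (√(v q)),
        mul_assoc, ← abs_of_nonneg (Real.sqrt_nonneg ((n / (q + 4) : ℕ) : ℝ)), ← abs_mul,
        abs_of_nonneg (Real.sqrt_nonneg ((n / (q + 4) : ℕ) : ℝ))]
      congr 2
      ring
  · have hc : Tendsto c atTop (nhds 0) := by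
      have := (hinv.const_mul (45 / 8)).sqrt
      rw [mul_zero, Real.sqrt_zero] at this
      refine this.congr fun q => ?_
      simp only [c]
      congr 1
      push_cast
      field_simp
    simpa using (hc.mul_const √w).const_mul |t|
  · have hN : Tendsto (fun n : ℕ => n / (q + 4)) atTop atTop :=
      Nat.tendsto_div_const_atTop (by omega)
    refine ((tendsto_charFun_blockSum q (c q * t)).comp hN).congr fun n => ?_
    simp only [Function.comp_apply, mul_assoc (c q)]
    rw [charFun_map_mul_comp (f := fun x => (√((n / (q + 4) : ℕ) : ℝ))⁻¹ *
      ∑ b ∈ Finset.range (n / (q + 4)), blockSum q b x)]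
    exact Measurable.aemeasurable (by fun_prop)
  · have hvc : Tendsto (fun q => v q * (c q * t) ^ 2 / 2) atTop (nhds (t ^ 2 / 2)) := by
      -- Since `v q = 8(q + 4)/45 - 29/90`, the limiting variance `v q * c q ^ 2` equals `1 -
      -- (29/16)/(q + 4)`.
      have h := ((hinv.const_mul (-(29 / 16))).const_add 1).mul_const (t ^ 2 / 2)
      rw [mul_zero, add_zero, one_mul] at h
      refine h.congr fun q => ?_
      rw [mul_pow, hc2]
      simp only [v]
      field_simp
      ring
    exact (Complex.continuous_exp.comp (Complex.continuous_ofReal.comp continuous_neg)).tendsto _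
      |>.comp hvc |>.congr (by intro q; simp) |>.trans_eq (by simp)

/-! ### The theorem for uniform permutations -/

theorem theorem1
    {Ω : ℕ → Type*} [∀ n, MeasurableSpace (Ω n)]
    (P : ∀ n, Measure (Ω n)) [∀ n, IsProbabilityMeasure (P n)]
    (τ : ∀ n, Ω n → Equiv.Perm (Fin n))
    (hτ : ∀ n, HasLaw (τ n) (uniformPerm n) (P n))
    {Ω' : Type*} [MeasurableSpace Ω'] (P' : Measure Ω') [IsProbabilityMeasure P']
    (Z : Ω' → ℝ) (hZ : HasLaw Z (gaussianReal 0 1) P') :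
    (∀ n : ℕ, 2 ≤ n →
      ∫ ω, (LA (τ n ω) : ℝ) ∂(P n) = 2 * (n : ℝ) / 3 + 1 / 6) ∧
    (∀ n : ℕ, 4 ≤ n →
      Var[fun ω => (LA (τ n ω) : ℝ); P n] = 8 * (n : ℝ) / 45 - 13 / 180) ∧
    TendstoInDistribution
      (fun (n : ℕ) (ω : Ω n) =>
        ((LA (τ n ω) : ℝ) - 2 * (n : ℝ) / 3) / Real.sqrt (8 * (n : ℝ) / 45))
      atTop Z P P' := by
  have hident : ∀ n, IdentDistrib (fun ω => (LA (τ (n + 1) ω) : ℝ)) (fun x => (altCount x n : ℝ))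
      (P (n + 1)) iidGaussian := fun n =>
    (identDistrib_LA_altCount (hτ (n + 1))).comp (measurable_from_nat (f := fun m => (m : ℝ)))
  refine ⟨fun n hn => ?_, fun n hn => ?_, ?_⟩
  · obtain ⟨m, rfl⟩ : ∃ m, n = m + 2 := ⟨n - 2, by omega⟩
    rw [(hident (m + 1)).integral_eq, integral_altCount]
    push_cast
    rfl
  · obtain ⟨m, rfl⟩ : ∃ m, n = m + 4 := ⟨n - 4, by omega⟩
    rw [(hident (m + 3)).variance_eq, variance_altCount]
    push_cast
    rfl
  · refine ⟨fun n => ?_, hZ.aemeasurable, ?_⟩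
    · exact (Measurable.of_discrete (f := fun π : Equiv.Perm (Fin n) =>
        ((LA π : ℝ) - 2 * (n : ℝ) / 3) / √(8 * (n : ℝ) / 45))).comp_aemeasurable (hτ n).aemeasurable
    · refine ProbabilityMeasure.tendsto_iff_tendsto_charFun.2 fun t => ?_
      simp only [ProbabilityMeasure.coe_mk, hZ.map_eq, charFun_gaussianReal]
      refine ((tendsto_charFun_normalizedCount t).congr' ?_).trans_eq (by simp)
      filter_upwards [eventually_gt_atTop 0] with n hn
      obtain ⟨m, rfl⟩ : ∃ m, n = m + 1 := ⟨n - 1, by omega⟩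
      have h := (hident m).comp (u := fun y : ℝ =>
        (y - 2 * ((m + 1 : ℕ) : ℝ) / 3) / √(8 * ((m + 1 : ℕ) : ℝ) / 45)) (by fun_prop)
      exact congrArg (fun μ => charFun μ t) h.map_eq.symm
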